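/- All graphs are finite and simple. For a graph $G$: * $\bar\omega(G)$ is the maximum integer $s$ such that $K_{s,s}$ is a (not necessarily induced) subgraph of $G$. * $\mathrm{tww}(G)$ is the twin-width of $G$: the minimum $d$ such that $G$ can be reduced to a single node by successively contracting pairs of nodes so that every trigraph in the sequence has maximum red degree at most $d$. When $X$ and $Y$ are contracted, a node adjacent (in black or red) to $X$ or to $Y$ becomes adjacent to $X\cup Y$, by a black edge if it was adjacent by a black edge to both of them, and by a red edge otherwise; all other adjacencies are kept. * $\mathrm{adm}_r(G)=\min_L\max_{v\in V(G)} b_r(L,v)$, where $L$ ranges over the linear orders of $V(G)$ and $b_r(L,v)$ is the maximum number of paths of length at most $r$ in $G$ that start in $v$, pairwise share no vertex except $v$, and end at vertices that lie before $v$ in $L$. For integers $d\ge 2$ and $r\ge 4$ let $G^d_r$ be the graph obtained from the complete graph on $d^{2(r-1)}$ vertices by subdividing each edge $r-1$ times. **Corollary.** There is a constant $\varepsilon>0$ such that for all integers $d\ge 2$, $r\ge 4$, $s\ge 1$ and $n\ge 1$ there is a graph $G$ that is (isomorphic to) the lexicographic product with $K_s$ of a disjoint union of $m$ copies of $G^d_r$,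 for some $m\ge 1$, and that satisfies: * $G$ is $K_{s+1,s+1}$-free (no $K_{s+1,s+1}$ subgraph) and $|G|\ge n$; * $\bar\omega(G)=s$ and $\mathrm{tww}(G)\ge d$; * $\mathrm{adm}_r(G)\ \ge\ (\log\log \mathrm{tww}(G))^{\varepsilon}\;\bar\omega(G)$, where $\log$ is the logarithm to base $2$ (so $\log\log\mathrm{tww}(G)\ge 0$). -/

import Mathlib

namespace TwinWidthAdm

/-- A trigraph on a graph with vertex set `V`: its nodes form a partition of `V`, and it has a
black and a red adjacency between nodes, which exclude each other. -/
structure Trigraph (V : Type*) where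
  nodes : Set (Set V)
  isPartition : Setoid.IsPartition nodes
  black : SimpleGraph (Set V)
  red : SimpleGraph (Set V)
  black_mem : ∀ X Y, black.Adj X Y → X ∈ nodes
  red_mem : ∀ X Y, red.Adj X Y → X ∈ nodes
  exclusive : ∀ X Y, black.Adj X Y → ¬ red.Adj X Y

namespace Trigraph

variable {V : Type*}

/-- The set of all neighbours of a node (by black or red edges). -/
def nbr (T : Trigraph V) (X : Set V) : Set (Set V) :=
  T.black.neighborSet X ∪ T.red.neighborSet X

/-- A `d`-trigraph: every node has at most `d` red neighbours. -/
def RedDegreeLE (T : Trigraph V) (d : ℕ) : Prop :=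
  ∀ X ∈ T.nodes, (T.red.neighborSet X).encard ≤ d

/-- `T` is the trigraph of singletons that is isomorphic to `G`. -/
def IsInitial (T : Trigraph V) (G : SimpleGraph V) : Prop :=
  T.nodes = Set.range (fun v : V => ({v} : Set V)) ∧
  (∀ u v : V, T.black.Adj {u} {v} ↔ G.Adj u v) ∧
  T.red = ⊥

/-- `T'` is obtained from `T` by contracting two distinct nodes `X` and `Y`. -/
def IsContraction (T T' : Trigraph V) : Prop :=
  ∃ X ∈ T.nodes, ∃ Y ∈ T.nodes, X ≠ Y ∧
    T'.nodes = (T.nodes \ {X, Y}) ∪ {X ∪ Y} ∧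
    T'.nbr (X ∪ Y) = (T.nbr X ∪ T.nbr Y) \ {X, Y} ∧
    T'.black.neighborSet (X ∪ Y) = T.black.neighborSet X ∩ T.black.neighborSet Y ∧
    ∀ Z ∈ T.nodes \ {X, Y}, ∀ W ∈ T.nodes \ {X, Y},
      (T'.black.Adj Z W ↔ T.black.Adj Z W) ∧ (T'.red.Adj Z W ↔ T.red.Adj Z W)

end Trigraph

/-- `T n, …, T 1`, where `n` is the number of vertices of `G`, is a `d`-contraction sequence
of `G`. (Values of `T` at other indices are irrelevant.) -/
def IsContractionSequence {V : Type*} (G : SimpleGraph V) (d : ℕ) (T : ℕ → Trigraph V) : Prop :=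
  (T (Nat.card V)).IsInitial G ∧
  (T 1).nodes = {Set.univ} ∧
  (∀ i, 1 ≤ i → i < Nat.card V → (T (i + 1)).IsContraction (T i)) ∧
  (∀ i, 1 ≤ i → i ≤ Nat.card V → (T i).RedDegreeLE d)

/-- The twin-width of a (finite, non-empty) graph. -/
noncomputable def tww {V : Type*} (G : SimpleGraph V) : ℕ :=
  sInf {d | ∃ T : ℕ → Trigraph V, IsContractionSequence G d T}

/-- The maximum integer `s` such that `K_{s,s}` is a (not necessarily induced) subgraph of the
finite graph `G`. -/
noncomputable def bomega {V : Type*} (G : SimpleGraph V) : ℕ :=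
  sSup {s | (completeBipartiteGraph (Fin s) (Fin s)).IsContained G}

/-- There are `k` paths of length at most `r` in `G` that start in `v`, pairwise share no vertex
except `v`, and end at vertices that lie before `v` in the linear order `L`. -/
def HasBackPaths {V : Type*} (G : SimpleGraph V) (r : ℕ) (L : LinearOrder V) (v : V) (k : ℕ) :
    Prop :=
  ∃ (u : Fin k → V) (p : ∀ i, G.Walk v (u i)),
    (∀ i, (p i).IsPath ∧ (p i).length ≤ r ∧ L.lt (u i) v) ∧
    ∀ i j, i ≠ j → ∀ w, w ∈ (p i).support → w ∈ (p j).support → w = v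

/-- The `r`-backconnectivity of `v` in `G` with respect to the linear order `L`. -/
noncomputable def backConn {V : Type*} (G : SimpleGraph V) (r : ℕ) (L : LinearOrder V) (v : V) :
    ℕ :=
  sSup {k | HasBackPaths G r L v k}

/-- The `r`-admissibility of a finite graph. -/
noncomputable def adm {V : Type*} (r : ℕ) (G : SimpleGraph V) : ℕ :=
  ⨅ L : LinearOrder V, ⨆ v : V, backConn G r L v

/-- The vertices of the clique on `Fin N` with each edge subdivided `k` times: the original
vertices, and `k` new vertices for each pair `i < j`. -/
abbrev SubdivVertex (N k : ℕ) : Type :=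
  Fin N ⊕ ({e : Fin N × Fin N // e.1 < e.2} × Fin k)

/-- The vertex at position `t` (with `0 ≤ t ≤ k + 1`) of the path that replaces the edge
`e = (i, j)`: position `0` is `i`, position `k + 1` is `j`. -/
def subdivPoint {N k : ℕ} (e : {e : Fin N × Fin N // e.1 < e.2}) (t : ℕ) : SubdivVertex N k :=
  if t = 0 then Sum.inl e.1.1
  else if h : t - 1 < k then Sum.inr (e, ⟨t - 1, h⟩)
  else Sum.inl e.1.2

/-- The complete graph on `N` vertices with each edge subdivided `k` times. -/
def subdividedClique (N k : ℕ) : SimpleGraph (SubdivVertex N k) :=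
  SimpleGraph.fromRel fun a b =>
    ∃ e : {e : Fin N × Fin N // e.1 < e.2}, ∃ t ≤ k, a = subdivPoint e t ∧ b = subdivPoint e (t + 1)

/-- The disjoint union of `m` copies of `G`. -/
def copies {V : Type*} (m : ℕ) (G : SimpleGraph V) : SimpleGraph (Fin m × V) where
  Adj a b := a.1 = b.1 ∧ G.Adj a.2 b.2
  symm := ⟨fun _ _ h => ⟨h.1.symm, h.2.symm⟩⟩
  loopless := ⟨fun _ h => h.2.ne rfl⟩

/-- The lexicographic product of `G` and `H`. -/
def lexProduct {V W : Type*} (G : SimpleGraph V) (H : SimpleGraph W) : SimpleGraph (V × W) where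
  Adj a b := G.Adj a.1 b.1 ∨ (a.1 = b.1 ∧ H.Adj a.2 b.2)
  symm := ⟨fun _ _ h => h.imp (fun h => h.symm) (fun h => ⟨h.1.symm, h.2.symm⟩)⟩
  loopless := ⟨fun _ h => h.elim (fun h => h.ne rfl) (fun h => h.2.ne rfl)⟩

end TwinWidthAdm

/-! Write `N = d ^ (2 * k)` with `k = r - 1`, and let `G` be the product of `n` copies of the
subdivided clique with `K_s`. The exponent `ε = 1` works, because admissibility is at least `(N - 1)
* s` while `log log tww` is at most `N - 1`.

Admissibility (`le_adm_blownUpCopies`): in any order, the last branch vertex of one copy reaches all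
layers of the other `N - 1` branch vertices along disjoint subdivided edges of length `r`.

Bicliques (`completeBipartite_free_lexProduct`): the base graph has no triangle and no four-cycle,
so a `K_{s+1,s+1}` would have to fit into the `2 * s` vertices above a single edge.

Lower bound on twin-width (`pred_le_of_colouring`): stop when two branch vertices first share a
node. The nodes met at distance `t` from one of them grow by a factor of at most `D + 2` per step,
where `D` bounds the red degree, yet at distance `k + 1` there must be `N - 1` of them. Hence `N - 1
≤ (D + 1) * (D + 2) ^ k`, which fails for `D < d`.

Upper bound on twin-width (`exists_isContractionSequence_of_rank`): collapse the copies of `K_s`,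
then absorb the vertices one by one into a single growing node. Its red neighbours stay within one
copy, so the bound is the order of one copy, whatever the number of copies; this order is below `2 ^
(N - 1)`. -/

namespace TwinWidthAdm

/-! ### Adjacency and short cycles in subdivided cliques -/

section Subdivision

variable {N k : ℕ}

theorem subdivPoint_zero (e : {e : Fin N × Fin N // e.1 < e.2}) :
    subdivPoint (k := k) e 0 = Sum.inl e.1.1 := by
  simp [subdivPoint]

theorem subdivPoint_succ (e : {e : Fin N × Fin N // e.1 < e.2}) {t : ℕ} (h : t < k) :
    subdivPoint e (t + 1) = Sum.inr (e, ⟨t, h⟩) := by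
  simp [subdivPoint, h]

theorem subdivPoint_last (e : {e : Fin N × Fin N // e.1 < e.2}) :
    subdivPoint (k := k) e (k + 1) = Sum.inl e.1.2 := by
  simp [subdivPoint]

theorem subdivPoint_eq_inl {e : {e : Fin N × Fin N // e.1 < e.2}} {t : ℕ} {a : Fin N}
    (ht : t ≤ k + 1) (h : subdivPoint (k := k) e t = Sum.inl a) :
    (t = 0 ∧ a = e.1.1) ∨ (t = k + 1 ∧ a = e.1.2) := by
  unfold subdivPoint at h
  split_ifs at h with h1 h2
  · exact Or.inl ⟨h1, (Sum.inl.inj h).symm⟩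
  · exact Or.inr ⟨by omega, (Sum.inl.inj h).symm⟩

theorem subdivPoint_eq_inr {e e' : {e : Fin N × Fin N // e.1 < e.2}} {t : ℕ} {i : Fin k}
    (h : subdivPoint e t = Sum.inr (e', i)) : e = e' ∧ t = i + 1 := by
  unfold subdivPoint at h
  split_ifs at h with h1 h2
  have h3 := Sum.inr.inj h
  simp only [Prod.mk.injEq] at h3
  refine ⟨h3.1, ?_⟩
  rw [← h3.2]
  simp only
  omega

theorem subdividedClique_adj {a b : SubdivVertex N k} (h : (subdividedClique N k).Adj a b) :
    ∃ e : {e : Fin N × Fin N // e.1 < e.2}, ∃ t t', t ≤ k + 1 ∧ t' ≤ k + 1 ∧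
      (t' = t + 1 ∨ t = t' + 1) ∧ subdivPoint e t = a ∧ subdivPoint e t' = b := by
  rw [subdividedClique, SimpleGraph.fromRel_adj] at h
  rcases h with ⟨-, ⟨e, t, ht, rfl, rfl⟩ | ⟨e, t, ht, rfl, rfl⟩⟩
  · exact ⟨e, t, t + 1, by omega, by omega, by omega, rfl, rfl⟩
  · exact ⟨e, t + 1, t, by omega, by omega, by omega, rfl, rfl⟩

theorem not_adj_inl_inl (hk : 1 ≤ k) (a b : Fin N) :
    ¬ (subdividedClique N k).Adj (Sum.inl a) (Sum.inl b) := by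
  intro h
  obtain ⟨e, t, t', h1, h2, h3, h4, h5⟩ := subdividedClique_adj h
  have := subdivPoint_eq_inl h1 h4
  have := subdivPoint_eq_inl h2 h5
  have hne := h.ne
  grind

theorem adj_inl_inr {a : Fin N} {e : {e : Fin N × Fin N // e.1 < e.2}} {i : Fin k}
    (h : (subdividedClique N k).Adj (Sum.inl a) (Sum.inr (e, i))) :
    (a = e.1.1 ∧ (i : ℕ) = 0) ∨ (a = e.1.2 ∧ (i : ℕ) + 1 = k) := by
  obtain ⟨e', t, t', h1, h2, h3, h4, h5⟩ := subdividedClique_adj h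
  have h6 := subdivPoint_eq_inl h1 h4
  obtain ⟨rfl, h7⟩ := subdivPoint_eq_inr h5
  have := i.2
  rcases h6 with ⟨h6, h8⟩ | ⟨h6, h8⟩
  · exact Or.inl ⟨h8, by omega⟩
  · exact Or.inr ⟨h8, by omega⟩

theorem adj_inr_inr {e e' : {e : Fin N × Fin N // e.1 < e.2}} {i j : Fin k}
    (h : (subdividedClique N k).Adj (Sum.inr (e, i)) (Sum.inr (e', j))) :
    e = e' ∧ ((i : ℕ) + 1 = j ∨ (j : ℕ) + 1 = i) := by
  obtain ⟨e', t, t', h1, h2, h3, h4, h5⟩ := subdividedClique_adj h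
  obtain ⟨rfl, h6⟩ := subdivPoint_eq_inr h4
  obtain ⟨rfl, h7⟩ := subdivPoint_eq_inr h5
  exact ⟨rfl, by omega⟩

theorem subdivPoint_inj {e e' : {e : Fin N × Fin N // e.1 < e.2}} {t t' : ℕ}
    (h0 : t ≠ 0) (h1 : t ≤ k) (h : subdivPoint (k := k) e t = subdivPoint e' t') :
    e = e' ∧ t = t' := by
  obtain ⟨t, rfl⟩ := Nat.exists_eq_succ_of_ne_zero h0
  rw [Nat.succ_eq_add_one, subdivPoint_succ e (by omega)] at h
  have := subdivPoint_eq_inr h.symm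
  exact ⟨this.1.symm, this.2.symm⟩

theorem adj_subdivPoint (hk : 1 ≤ k) (e : {e : Fin N × Fin N // e.1 < e.2}) {t : ℕ}
    (ht : t ≤ k) : (subdividedClique N k).Adj (subdivPoint e t) (subdivPoint e (t + 1)) := by
  rw [subdividedClique, SimpleGraph.fromRel_adj]
  refine ⟨fun h => ?_, Or.inl ⟨e, t, ht, rfl, rfl⟩⟩
  rcases Nat.eq_zero_or_pos t with rfl | h0
  · have := (subdivPoint_inj (by omega) (by omega) h.symm).2
    omega
  · have := (subdivPoint_inj (by omega) ht h).2
    omega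

theorem inl_eq_of_common_neighbor (hk : 2 ≤ k) {a b : Fin N} {y : SubdivVertex N k}
    (ha : (subdividedClique N k).Adj (Sum.inl a) y)
    (hb : (subdividedClique N k).Adj (Sum.inl b) y) : a = b := by
  rcases y with c | ⟨e, i⟩
  · exact (not_adj_inl_inl (by omega) _ _ ha).elim
  · have h1 := adj_inl_inr ha
    have h2 := adj_inl_inr hb
    rcases h1 with ⟨h1, h1'⟩ | ⟨h1, h1'⟩ <;> rcases h2 with ⟨h2, h2'⟩ | ⟨h2, h2'⟩ <;>
      first | exact h1.trans h2.symm | omega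

theorem eq_of_adj_inl_of_adj_inr {a : Fin N} {e : {e : Fin N × Fin N // e.1 < e.2}}
    {i : Fin k} {z w : SubdivVertex N k} (hk : 2 ≤ k)
    (h1 : (subdividedClique N k).Adj (Sum.inl a) z)
    (h2 : (subdividedClique N k).Adj (Sum.inl a) w)
    (h3 : (subdividedClique N k).Adj (Sum.inr (e, i)) z)
    (h4 : (subdividedClique N k).Adj (Sum.inr (e, i)) w) : z = w := by
  rcases z with z | ⟨e1, z⟩
  · exact (not_adj_inl_inl (by omega) _ _ h1).elim
  rcases w with w | ⟨e2, w⟩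
  · exact (not_adj_inl_inl (by omega) _ _ h2).elim
  obtain ⟨rfl, h3⟩ := adj_inr_inr h3
  obtain ⟨rfl, h4⟩ := adj_inr_inr h4
  have h1 := adj_inl_inr h1
  have h2 := adj_inl_inr h2
  have he := e.2.ne
  have : (z : ℕ) = w := by omega
  rw [Fin.ext this]

/-- For `k ≥ 2` the subdivided clique has no cycle of length four. -/
theorem eq_or_eq_of_four_cycle (hk : 2 ≤ k) {x y z w : SubdivVertex N k}
    (hxz : (subdividedClique N k).Adj x z) (hxw : (subdividedClique N k).Adj x w)
    (hyz : (subdividedClique N k).Adj y z) (hyw : (subdividedClique N k).Adj y w) :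
    x = y ∨ z = w := by
  rcases x with x | ⟨ex, x⟩ <;> rcases y with y | ⟨ey, y⟩
  · exact Or.inl (congrArg _ (inl_eq_of_common_neighbor hk hxz hyz))
  · exact Or.inr (eq_of_adj_inl_of_adj_inr hk hxz hxw hyz hyw)
  · exact Or.inr (eq_of_adj_inl_of_adj_inr hk hyz hyw hxz hxw)
  rcases z with z | ⟨ez, z⟩ <;> rcases w with w | ⟨ew, w⟩
  · exact Or.inr (congrArg _ (inl_eq_of_common_neighbor hk hxz.symm hxw.symm))
  · exact Or.inl (eq_of_adj_inl_of_adj_inr hk hxz.symm hyz.symm hxw.symm hyw.symm)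
  · exact Or.inl (eq_of_adj_inl_of_adj_inr hk hxw.symm hyw.symm hxz.symm hyz.symm)
  obtain ⟨rfl, h1⟩ := adj_inr_inr hxz
  obtain ⟨rfl, h2⟩ := adj_inr_inr hxw
  obtain ⟨rfl, h3⟩ := adj_inr_inr hyz
  obtain ⟨-, h4⟩ := adj_inr_inr hyw
  have : (x : ℕ) = y ∨ (z : ℕ) = w := by omega
  rcases this with h | h
  · exact Or.inl (by rw [Fin.ext h])
  · exact Or.inr (by rw [Fin.ext h])

theorem not_triangle_inl (hk : 3 ≤ k) {a : Fin N} {y z : SubdivVertex N k}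
    (hy : (subdividedClique N k).Adj (Sum.inl a) y)
    (hz : (subdividedClique N k).Adj (Sum.inl a) z)
    (hyz : (subdividedClique N k).Adj y z) : False := by
  rcases y with y | ⟨e1, y⟩
  · exact (not_adj_inl_inl (by omega) _ _ hy).elim
  rcases z with z | ⟨e2, z⟩
  · exact (not_adj_inl_inl (by omega) _ _ hz).elim
  obtain ⟨rfl, h⟩ := adj_inr_inr hyz
  have h1 := adj_inl_inr hy
  have h2 := adj_inl_inr hz
  omega

/-- For `k ≥ 3` the subdivided clique has no triangle. -/
theorem not_triangle (hk : 3 ≤ k) {x y z : SubdivVertex N k}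
    (hxy : (subdividedClique N k).Adj x y) (hxz : (subdividedClique N k).Adj x z)
    (hyz : (subdividedClique N k).Adj y z) : False := by
  rcases x with x | ⟨ex, x⟩
  · exact not_triangle_inl hk hxy hxz hyz
  rcases y with y | ⟨ey, y⟩
  · exact not_triangle_inl hk hxy.symm hyz hxz
  rcases z with z | ⟨ez, z⟩
  · exact not_triangle_inl hk hxz.symm hyz.symm hxy
  have h1 := (adj_inr_inr hxy).2
  have h2 := (adj_inr_inr hxz).2
  have h3 := (adj_inr_inr hyz).2
  omega

/-- The vertex at position `t` of the path from `x` to `w` that replaces the edge `xw`. -/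
def edgePoint (x w : Fin N) (t : ℕ) : SubdivVertex N k :=
  if h : x < w then subdivPoint ⟨(x, w), h⟩ t
  else if h : w < x then subdivPoint ⟨(w, x), h⟩ (k + 1 - t)
  else Sum.inl x

theorem edgePoint_zero (x w : Fin N) : edgePoint (k := k) x w 0 = Sum.inl x := by
  unfold edgePoint
  split_ifs with h1 h2
  · exact subdivPoint_zero _
  · exact subdivPoint_last _
  · rfl

theorem edgePoint_last (x w : Fin N) : edgePoint (k := k) x w (k + 1) = Sum.inl w := by
  unfold edgePoint
  split_ifs with h1 h2
  · exact subdivPoint_last _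
  · rw [Nat.sub_self]
    exact subdivPoint_zero _
  · rw [le_antisymm (not_lt.1 h2) (not_lt.1 h1)]

theorem adj_edgePoint (hk : 1 ≤ k) {x w : Fin N} (hxw : w ≠ x) {t : ℕ} (ht : t ≤ k) :
    (subdividedClique N k).Adj (edgePoint x w t) (edgePoint x w (t + 1)) := by
  unfold edgePoint
  split_ifs with h1 h2
  · exact adj_subdivPoint hk _ ht
  · have := adj_subdivPoint (N := N) hk ⟨(w, x), h2⟩ (t := k + 1 - (t + 1)) (by omega)
    rw [show k + 1 - (t + 1) + 1 = k + 1 - t by omega] at this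
    exact this.symm
  · exact absurd (le_antisymm (not_lt.1 h1) (not_lt.1 h2)) hxw

theorem edgePoint_inj {x w w' : Fin N} (hw : w ≠ x) (hw' : w' ≠ x) {t t' : ℕ}
    (h0 : t ≠ 0) (h1 : t ≤ k + 1) (h0' : t' ≠ 0) (h1' : t' ≤ k + 1)
    (h : edgePoint (k := k) x w t = edgePoint x w' t') : w = w' ∧ t = t' := by
  -- With `t` interior, the point determines its edge and its position on it. Edges `xw` and `xw'`
  -- of opposite orientation would coincide only if `w = x`.
  have key : ∀ {w w' : Fin N} {t t' : ℕ}, w ≠ x → w' ≠ x → t ≠ 0 → t ≤ k → t' ≠ 0 →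
      t' ≤ k + 1 → edgePoint (k := k) x w t = edgePoint x w' t' → w = w' ∧ t = t' := by
    intro w w' t t' hw hw' h0 h1 h0' h1' h
    unfold edgePoint at h
    rcases lt_or_gt_of_ne hw with h2 | h2 <;> rcases lt_or_gt_of_ne hw' with h3 | h3 <;>
      simp only [h2, h3, h2.not_gt, h3.not_gt, dif_pos, dif_neg, not_false_eq_true] at h
    · have := subdivPoint_inj (by omega) (by omega) h
      simp only [Subtype.mk.injEq, Prod.mk.injEq] at this
      exact ⟨this.1.1, by omega⟩
    · have := subdivPoint_inj (by omega) (by omega) h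
      simp only [Subtype.mk.injEq, Prod.mk.injEq] at this
      exact absurd this.1.1 hw
    · have := subdivPoint_inj (by omega) (by omega) h
      simp only [Subtype.mk.injEq, Prod.mk.injEq] at this
      exact absurd this.1.1.symm hw'
    · have := subdivPoint_inj (by omega) (by omega) h
      simp only [Subtype.mk.injEq, Prod.mk.injEq] at this
      exact ⟨this.1.2, by omega⟩
  rcases Nat.lt_or_ge k t with h2 | h2
  · rcases Nat.lt_or_ge k t' with h3 | h3
    · obtain rfl : t = k + 1 := by omega
      obtain rfl : t' = k + 1 := by omega
      rw [edgePoint_last, edgePoint_last] at h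
      exact ⟨Sum.inl.inj h, rfl⟩
    · have := key hw' hw h0' h3 h0 h1 h.symm
      exact ⟨this.1.symm, this.2.symm⟩
  · exact key hw hw' h0 h2 h0' h1' h

theorem edgePoint_ne_inl {x w : Fin N} (hw : w ≠ x) {t : ℕ} (h0 : t ≠ 0) (h1 : t ≤ k + 1) :
    edgePoint (k := k) x w t ≠ Sum.inl x := by
  intro h
  unfold edgePoint at h
  split_ifs at h with h2 h3
  · rcases subdivPoint_eq_inl h1 h with h4 | h4
    · exact h0 h4.1
    · exact hw h4.2.symm
  · rcases subdivPoint_eq_inl (by omega) h with h4 | h4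
    · exact hw h4.2.symm
    · omega
  · exact hw (le_antisymm (not_lt.1 h2) (not_lt.1 h3))

end Subdivision

/-- The lexicographic product with `K_s` of `m` disjoint copies of a subdivided clique. -/
abbrev blownUpCopies (m N k s : ℕ) : SimpleGraph ((Fin m × SubdivVertex N k) × Fin s) :=
  lexProduct (copies m (subdividedClique N k)) (⊤ : SimpleGraph (Fin s))

/-! ### Bicliques in the lexicographic product -/

section Biclique

variable {W : Type*} {s : ℕ}

/-- A fibre has only `s` vertices, so each side of the biclique projects to at least two vertices of
`H`. The projections of both sides turn out to be the same two vertices, which leaves room for `2 *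
s` vertices instead of `2 * s + 2`. -/
theorem completeBipartite_free_lexProduct (H : SimpleGraph W)
    (htri : ∀ x y z, H.Adj x y → H.Adj x z → ¬ H.Adj y z)
    (hcyc : ∀ x y z w, H.Adj x z → H.Adj x w → H.Adj y z → H.Adj y w → x = y ∨ z = w) :
    (completeBipartiteGraph (Fin (s + 1)) (Fin (s + 1))).Free
      (lexProduct H (⊤ : SimpleGraph (Fin s))) := by
  rintro ⟨f⟩
  have hadj : ∀ i j, (f (Sum.inl i)).1 = (f (Sum.inr j)).1 ∨
      H.Adj (f (Sum.inl i)).1 (f (Sum.inr j)).1 := by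
    intro i j
    have h : (completeBipartiteGraph (Fin (s + 1)) (Fin (s + 1))).Adj (Sum.inl i) (Sum.inr j) := by
      simp
    rcases f.toHom.map_adj h with h | h
    · exact Or.inr h
    · exact Or.inl h.1
  have hpair : ∀ g : Fin (s + 1) → W × Fin s, Function.Injective g →
      ∃ i j, (g i).1 ≠ (g j).1 := by
    intro g hg
    by_contra! hcon
    have : Function.Injective fun i => (g i).2 := fun i j hij =>
      hg (Prod.ext (hcon i j) hij)
    have := Fintype.card_le_of_injective _ this
    simp at this
  obtain ⟨i, i', hi⟩ := hpair (fun i => f (Sum.inl i)) (f.injective.comp Sum.inl_injective)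
  obtain ⟨j, j', hj⟩ := hpair (fun i => f (Sum.inr i)) (f.injective.comp Sum.inr_injective)
  -- Each of the four cross pairs is equal or adjacent. Four adjacencies form a four-cycle, and
  -- exactly one equality forms a triangle, so the two pairs of projections are matched by equality.
  have key : ∀ i i' j j', (f (Sum.inl i)).1 ≠ (f (Sum.inl i')).1 →
      (f (Sum.inr j)).1 ≠ (f (Sum.inr j')).1 →
      ((f (Sum.inl i)).1 = (f (Sum.inr j)).1 ∧ (f (Sum.inl i')).1 = (f (Sum.inr j')).1) ∨
      ((f (Sum.inl i)).1 = (f (Sum.inr j')).1 ∧ (f (Sum.inl i')).1 = (f (Sum.inr j)).1) := by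
    intro i i' j j' hi hj
    have h1 := hadj i j
    have h2 := hadj i j'
    have h3 := hadj i' j
    have h4 := hadj i' j'
    generalize (f (Sum.inl i)).1 = x at *
    generalize (f (Sum.inl i')).1 = y at *
    generalize (f (Sum.inr j)).1 = z at *
    generalize (f (Sum.inr j')).1 = w at *
    grind [H.adj_comm]
  have hA : ∀ a, (f (Sum.inl a)).1 = (f (Sum.inl i)).1 ∨
      (f (Sum.inl a)).1 = (f (Sum.inl i')).1 := by
    intro a
    by_cases h : (f (Sum.inl a)).1 = (f (Sum.inl i)).1
    · exact Or.inl h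
    · have h1 := key a i j j' h hj
      have h2 := key i i' j j' hi hj
      grind
  have hB : ∀ a, (f (Sum.inr a)).1 = (f (Sum.inl i)).1 ∨
      (f (Sum.inr a)).1 = (f (Sum.inl i')).1 := by
    intro a
    by_cases h : (f (Sum.inr a)).1 = (f (Sum.inr j)).1
    · have h2 := key i i' j j' hi hj
      grind
    · have h1 := key i i' a j hi h
      grind
  classical
  have hsub : Finset.univ.image f ⊆
      ({(f (Sum.inl i)).1, (f (Sum.inl i')).1} : Finset W) ×ˢ (Finset.univ : Finset (Fin s)) := by
    intro p hp
    obtain ⟨a, -, rfl⟩ := Finset.mem_image.1 hp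
    simp only [Finset.mem_product, Finset.mem_insert, Finset.mem_singleton, Finset.mem_univ,
      and_true]
    rcases a with a | a
    · exact hA a
    · exact hB a
  have h1 := Finset.card_le_card hsub
  rw [Finset.card_image_of_injective _ (show Function.Injective f from f.injective),
    Finset.card_product] at h1
  have h2 : ({(f (Sum.inl i)).1, (f (Sum.inl i')).1} : Finset W).card ≤ 2 := Finset.card_le_two
  simp only [Finset.card_univ, Fintype.card_sum, Fintype.card_fin] at h1
  nlinarith

theorem completeBipartite_isContained_lexProduct (H : SimpleGraph W) {x y : W} (h : H.Adj x y) :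
    (completeBipartiteGraph (Fin s) (Fin s)).IsContained
      (lexProduct H (⊤ : SimpleGraph (Fin s))) := by
  refine ⟨⟨⟨Sum.elim (fun i => (x, i)) (fun i => (y, i)), ?_⟩, ?_⟩⟩
  · rintro (a | a) (b | b) hab
    · simp at hab
    · exact Or.inl h
    · exact Or.inl h.symm
    · simp at hab
  · rintro (a | a) (b | b) hab <;> simp_all [h.ne, h.ne.symm]

theorem bomega_eq {V : Type*} {G : SimpleGraph V} {s : ℕ}
    (h : (completeBipartiteGraph (Fin s) (Fin s)).IsContained G)
    (hfree : (completeBipartiteGraph (Fin (s + 1)) (Fin (s + 1))).Free G) : bomega G = s := by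
  have hub : ∀ t ∈ {t | (completeBipartiteGraph (Fin t) (Fin t)).IsContained G}, t ≤ s := by
    intro t ht
    by_contra! hlt
    refine hfree (SimpleGraph.IsContained.trans ?_ ht)
    refine ⟨⟨⟨Sum.map (Fin.castLE hlt) (Fin.castLE hlt), ?_⟩, ?_⟩⟩
    · rintro (a | a) (b | b) hab <;> simp at hab ⊢
    · exact Function.Injective.sumMap (Fin.castLE_injective _) (Fin.castLE_injective _)
  exact le_antisymm (csSup_le ⟨s, h⟩ hub) (le_csSup ⟨s, hub⟩ h)

end Biclique

/-! ### Lower bound on admissibility -/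

section Admissibility

variable {V : Type*} {G : SimpleGraph V} {r : ℕ}

theorem exists_walk_of_seq (f : ℕ → V) (l : ℕ) (h : ∀ t < l, G.Adj (f t) (f (t + 1))) :
    ∃ p : G.Walk (f 0) (f l), p.length = l ∧ p.support = (List.range (l + 1)).map f := by
  induction l with
  | zero => exact ⟨SimpleGraph.Walk.nil, rfl, rfl⟩
  | succ l ih =>
    obtain ⟨p, hl, hs⟩ := ih fun t ht => h t (by omega)
    refine ⟨p.concat (h l (by omega)), by simp [hl], ?_⟩
    rw [SimpleGraph.Walk.support_concat, hs, List.range_succ (n := l + 1)]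
    simp

theorem HasBackPaths.le_card [Finite V] {L : LinearOrder V} {v : V} {k : ℕ}
    (h : HasBackPaths G r L v k) : k ≤ Nat.card V := by
  obtain ⟨u, p, hp, hd⟩ := h
  have hinj : Function.Injective u := by
    intro i j hij
    by_contra hne
    have h1 : u i ∈ (p j).support := by
      rw [hij]
      exact (p j).end_mem_support
    have h2 := hd i j hne (u i) (p i).end_mem_support h1
    have h3 := (hp i).2.2
    rw [h2] at h3
    exact @lt_irrefl _ L.toPreorder v h3
  simpa using Nat.card_le_card_of_injective u hinj

theorem le_backConn [Finite V] {L : LinearOrder V} {v : V} {k : ℕ}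
    (h : HasBackPaths G r L v k) : k ≤ backConn G r L v :=
  le_csSup ⟨Nat.card V, fun _ hk => HasBackPaths.le_card hk⟩ h

theorem le_adm [Finite V] {k : ℕ} (h : ∀ L : LinearOrder V, ∃ v, HasBackPaths G r L v k) :
    k ≤ adm r G := by
  -- Over an empty family of orders the infimum in `ℕ` would be `0`, so some order has to be
  -- exhibited.
  obtain ⟨L₀⟩ : Nonempty (LinearOrder V) := by
    obtain ⟨n, ⟨e⟩⟩ := Finite.exists_equiv_fin V
    exact ⟨LinearOrder.lift' e e.injective⟩
  have : Nonempty (LinearOrder V) := ⟨L₀⟩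
  refine le_ciInf fun L => ?_
  obtain ⟨v, hv⟩ := h L
  exact (le_backConn hv).trans (le_ciSup (f := fun v => backConn G r L v)
    (Set.finite_range _).bddAbove v)

/-- Back paths given by vertex sequences indexed by an arbitrary finite type. -/
theorem hasBackPaths_of_seq {ι : Type*} [Fintype ι] {L : LinearOrder V} {v : V}
    (f : ι → ℕ → V) (h0 : ∀ i, f i 0 = v)
    (hadj : ∀ i, ∀ t < r, G.Adj (f i t) (f i (t + 1)))
    (hlt : ∀ i, L.lt (f i r) v)
    (hne : ∀ i, ∀ t ≤ r, t ≠ 0 → f i t ≠ v)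
    (hinj : ∀ i j, ∀ t ≤ r, ∀ t' ≤ r, t ≠ 0 → t' ≠ 0 → f i t = f j t' → i = j ∧ t = t') :
    HasBackPaths G r L v (Fintype.card ι) := by
  let e := (Fintype.equivFin ι).symm
  have hw : ∀ i, ∃ p : G.Walk v (f i r), p.length = r ∧
      p.support = (List.range (r + 1)).map (f i) := by
    intro i
    have := exists_walk_of_seq (f i) r (hadj i)
    rwa [h0] at this
  choose p hl hs using hw
  refine ⟨fun i => f (e i) r, fun i => p (e i), fun i => ⟨?_, (hl _).le, hlt _⟩, ?_⟩
  · rw [SimpleGraph.Walk.isPath_def, hs]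
    refine List.Nodup.map_on ?_ List.nodup_range
    intro t ht t' ht' htt
    rw [List.mem_range] at ht ht'
    by_cases h1 : t = 0 <;> by_cases h2 : t' = 0
    · omega
    · rw [h1, h0] at htt
      exact (hne _ t' (by omega) h2 htt.symm).elim
    · rw [h2, h0] at htt
      exact (hne _ t (by omega) h1 htt).elim
    · exact (hinj _ _ t (by omega) t' (by omega) h1 h2 htt).2
  · intro i j hij w hi hj
    rw [hs, List.mem_map] at hi hj
    obtain ⟨t, ht, rfl⟩ := hi
    obtain ⟨t', ht', htt⟩ := hj
    rw [List.mem_range] at ht ht'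
    by_cases h1 : t = 0
    · rw [h1, h0]
    · by_cases h2 : t' = 0
      · rw [← htt, h2, h0]
      · exact (hij (e.injective (hinj _ _ t (by omega) t' (by omega) h1 h2 htt.symm).1)).elim

end Admissibility

theorem le_adm_blownUpCopies {m N k s : ℕ} (hm : 1 ≤ m) (hN : 1 ≤ N) (hk : 1 ≤ k) (hs : 1 ≤ s) :
    (N - 1) * s ≤ adm (k + 1) (blownUpCopies m N k s) := by
  apply le_adm
  intro L
  let b : Fin N × Fin s → (Fin m × SubdivVertex N k) × Fin s :=
    fun q => ((⟨0, hm⟩, Sum.inl q.1), q.2)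
  have hb : Function.Injective b := by
    rintro ⟨x, i⟩ ⟨y, j⟩ h
    simp only [b, Prod.mk.injEq, Sum.inl.injEq, true_and] at h
    rw [h.1, h.2]
  obtain ⟨⟨x, i⟩, hmax⟩ : ∃ q, ∀ q', L.le (b q') (b q) := by
    have : Nonempty (Fin N × Fin s) := ⟨(⟨0, hN⟩, ⟨0, hs⟩)⟩
    obtain ⟨q, hq⟩ := @Finite.exists_max _ _ _ _ L b
    exact ⟨q, hq⟩
  refine ⟨b (x, i), ?_⟩
  have hcard : Fintype.card ({w : Fin N // w ≠ x} × Fin s) = (N - 1) * s := by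
    simp [Fintype.card_subtype_compl]
  rw [← hcard]
  refine hasBackPaths_of_seq
    -- The path to `(w, j)` enters layer `j` at its first step, since adjacent fibres are completely
    -- joined, and stays there. So the `s` paths towards the same `w` are disjoint.
    (fun q t => if t = 0 then b (x, i) else ((⟨0, hm⟩, edgePoint x q.1.1 t), q.2))
    (fun q => if_pos rfl) ?_ ?_ ?_ ?_
  · rintro ⟨⟨w, hw⟩, j⟩ t ht
    refine Or.inl ?_
    have h := adj_edgePoint (k := k) hk hw (t := t) (by omega)
    by_cases h0 : t = 0
    · subst h0
      rw [edgePoint_zero] at h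
      exact ⟨by simp [b], by simpa [b] using h⟩
    · simp only [h0, if_false, Nat.add_eq_zero_iff, one_ne_zero, and_false]
      exact ⟨rfl, h⟩
  · rintro ⟨⟨w, hw⟩, j⟩
    simp only [Nat.add_eq_zero_iff, one_ne_zero, and_false, if_false, edgePoint_last]
    refine @lt_of_le_of_ne _ L.toPartialOrder _ _ (hmax (w, j)) fun h => hw ?_
    exact congrArg Prod.fst (hb (a₁ := (w, j)) (a₂ := (x, i)) h)
  · rintro ⟨⟨w, hw⟩, j⟩ t ht h0 h
    simp only [h0, if_false, b, Prod.mk.injEq, true_and] at h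
    exact edgePoint_ne_inl hw h0 ht h.1
  · rintro ⟨⟨w, hw⟩, j⟩ ⟨⟨w', hw'⟩, j'⟩ t ht t' ht' h0 h0' h
    simp only [h0, h0', if_false, Prod.mk.injEq, true_and] at h
    obtain ⟨rfl, rfl⟩ := edgePoint_inj hw hw' h0 ht h0' ht' h.1
    rw [h.2]
    exact ⟨rfl, rfl⟩

/-! ### Partitions and their quotient trigraphs -/

section Partition

variable {V : Type*}

/-- The partition obtained from `C` by merging `X` and `Y`. -/
def mergeParts (C : Set (Set V)) (X Y : Set V) : Set (Set V) :=
  (C \ {X, Y}) ∪ {X ∪ Y}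

theorem eq_of_mem_parts {C : Set (Set V)} (hC : Setoid.IsPartition C) {X Y : Set V} (hX : X ∈ C)
    (hY : Y ∈ C) {x : V} (h1 : x ∈ X) (h2 : x ∈ Y) : X = Y :=
  (hC.2 x).unique ⟨hX, h1⟩ ⟨hY, h2⟩

theorem union_notMem_parts {C : Set (Set V)} (hC : Setoid.IsPartition C) {X Y : Set V}
    (hX : X ∈ C) (hY : Y ∈ C) (hXY : X ≠ Y) : X ∪ Y ∉ C := by
  intro h
  obtain ⟨x, hx⟩ := Setoid.nonempty_of_mem_partition hC hX
  obtain ⟨y, hy⟩ := Setoid.nonempty_of_mem_partition hC hY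
  have h1 := eq_of_mem_parts hC hX h hx (Or.inl hx)
  have h2 := eq_of_mem_parts hC hY h hy (Or.inr hy)
  exact hXY (h1.trans h2.symm)

theorem isPartition_mergeParts {C : Set (Set V)} (hC : Setoid.IsPartition C) {X Y : Set V}
    (hX : X ∈ C) (hY : Y ∈ C) : Setoid.IsPartition (mergeParts C X Y) := by
  refine ⟨?_, fun a => ?_⟩
  · rintro (h | h)
    · exact hC.1 h.1
    · obtain ⟨x, hx⟩ := Setoid.nonempty_of_mem_partition hC hX
      have h' : (∅ : Set V) = X ∪ Y := h
      exact Set.notMem_empty x (h' ▸ Or.inl hx)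
  · obtain ⟨Z, ⟨hZ, haZ⟩, huniq⟩ := hC.2 a
    by_cases hZXY : Z = X ∨ Z = Y
    · have haU : a ∈ X ∪ Y := by
        rcases hZXY with rfl | rfl
        · exact Or.inl haZ
        · exact Or.inr haZ
      refine ⟨X ∪ Y, ⟨Or.inr rfl, haU⟩, ?_⟩
      rintro W ⟨⟨hW, hW'⟩ | hW, haW⟩
      · rw [huniq W ⟨hW, haW⟩] at hW'
        exact (hW' hZXY).elim
      · exact hW
    · refine ⟨Z, ⟨Or.inl ⟨hZ, hZXY⟩, haZ⟩, ?_⟩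
      rintro W ⟨⟨hW, hW'⟩ | hW, haW⟩
      · exact huniq W ⟨hW, haW⟩
      · have hW' : W = X ∪ Y := hW
        rw [hW'] at haW
        rcases haW with h | h
        · exact (hZXY (Or.inl (huniq X ⟨hX, h⟩).symm)).elim
        · exact (hZXY (Or.inr (huniq Y ⟨hY, h⟩).symm)).elim

theorem ncard_mergeParts [Finite V] {C : Set (Set V)} (hC : Setoid.IsPartition C) {X Y : Set V}
    (hX : X ∈ C) (hY : Y ∈ C) (hXY : X ≠ Y) : (mergeParts C X Y).ncard + 1 = C.ncard := by
  have hsub : ({X, Y} : Set (Set V)) ⊆ C := by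
    rintro Z (rfl | rfl)
    · exact hX
    · exact hY
  have h1 : (C \ {X, Y}).ncard + ({X, Y} : Set (Set V)).ncard = C.ncard :=
    Set.ncard_sdiff_add_ncard_of_subset hsub
  rw [Set.ncard_pair hXY] at h1
  have h2 : (mergeParts C X Y).ncard = (C \ {X, Y}).ncard + 1 := by
    rw [mergeParts, Set.union_singleton]
    exact Set.ncard_insert_of_notMem fun h => union_notMem_parts hC hX hY hXY h.1
  omega

end Partition

section Quotient

variable {V : Type*} (G : SimpleGraph V)

/-- The trigraph that a partition of the vertices of a graph gives rise to. -/
def quotientTrigraph (C : Set (Set V)) (hC : Setoid.IsPartition C) : Trigraph V where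
  nodes := C
  isPartition := hC
  black :=
    { Adj := fun X Y => X ∈ C ∧ Y ∈ C ∧ X ≠ Y ∧ ∀ x ∈ X, ∀ y ∈ Y, G.Adj x y
      symm := ⟨fun _ _ h => ⟨h.2.1, h.1, h.2.2.1.symm, fun y hy x hx => (h.2.2.2 x hx y hy).symm⟩⟩
      loopless := ⟨fun _ h => h.2.2.1 rfl⟩ }
  red :=
    { Adj := fun X Y => X ∈ C ∧ Y ∈ C ∧ X ≠ Y ∧ (∃ x ∈ X, ∃ y ∈ Y, G.Adj x y) ∧
        ∃ x ∈ X, ∃ y ∈ Y, ¬ G.Adj x y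
      symm := ⟨by
        rintro X Y ⟨h1, h2, h3, ⟨x, hx, y, hy, h⟩, ⟨x', hx', y', hy', h'⟩⟩
        exact ⟨h2, h1, h3.symm, ⟨y, hy, x, hx, h.symm⟩, ⟨y', hy', x', hx', fun k => h' k.symm⟩⟩⟩
      loopless := ⟨fun _ h => h.2.2.1 rfl⟩ }
  black_mem := fun _ _ h => h.1
  red_mem := fun _ _ h => h.1
  exclusive := by
    rintro X Y h ⟨-, -, -, -, x, hx, y, hy, h'⟩
    exact h' (h.2.2.2 x hx y hy)

variable {G}

theorem mem_nbr_quotientTrigraph {C : Set (Set V)} {hC : Setoid.IsPartition C} {X Z : Set V} :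
    Z ∈ (quotientTrigraph G C hC).nbr X ↔
      X ∈ C ∧ Z ∈ C ∧ X ≠ Z ∧ ∃ x ∈ X, ∃ z ∈ Z, G.Adj x z := by
  constructor
  · rintro (⟨h1, h2, h3, h⟩ | ⟨h1, h2, h3, h, -⟩)
    · obtain ⟨x, hx⟩ := Setoid.nonempty_of_mem_partition hC h1
      obtain ⟨z, hz⟩ := Setoid.nonempty_of_mem_partition hC h2
      exact ⟨h1, h2, h3, x, hx, z, hz, h x hx z hz⟩
    · exact ⟨h1, h2, h3, h⟩
  · rintro ⟨h1, h2, h3, h⟩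
    by_cases hb : ∀ x ∈ X, ∀ z ∈ Z, G.Adj x z
    · exact Or.inl ⟨h1, h2, h3, hb⟩
    · push Not at hb
      exact Or.inr ⟨h1, h2, h3, h, hb⟩

theorem isContraction_quotientTrigraph {C : Set (Set V)} (hC : Setoid.IsPartition C)
    {X Y : Set V} (hX : X ∈ C) (hY : Y ∈ C) (hXY : X ≠ Y) :
    (quotientTrigraph G C hC).IsContraction
      (quotientTrigraph G (mergeParts C X Y) (isPartition_mergeParts hC hX hY)) := by
  have hU := union_notMem_parts hC hX hY hXY
  have hmem : ∀ Z, (Z ∈ mergeParts C X Y ∧ X ∪ Y ≠ Z) ↔ Z ∈ C ∧ Z ≠ X ∧ Z ≠ Y := by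
    intro Z
    constructor
    · rintro ⟨⟨h1, h2⟩ | h1, h3⟩
      · exact ⟨h1, fun h => h2 (Or.inl h), fun h => h2 (Or.inr h)⟩
      · exact (h3 h1.symm).elim
    · rintro ⟨h1, h2, h3⟩
      refine ⟨Or.inl ⟨h1, by rintro (h | h); exacts [h2 h, h3 h]⟩, ?_⟩
      rintro rfl
      exact hU h1
  have hUmem : X ∪ Y ∈ mergeParts C X Y := Or.inr rfl
  refine ⟨X, hX, Y, hY, hXY, rfl, ?_, ?_, ?_⟩
  · ext Z
    have h1 := hmem Z
    simp only [Set.mem_sdiff, Set.mem_union, mem_nbr_quotientTrigraph, Set.mem_insert_iff,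
      Set.mem_singleton_iff, hX, hY, hUmem, true_and, not_or]
    constructor
    · rintro ⟨h2, h3, x, hx, z, hz, hxz⟩
      obtain ⟨h4, h5, h6⟩ := h1.1 ⟨h2, h3⟩
      refine ⟨?_, h5, h6⟩
      rcases hx with hx | hx
      · exact Or.inl ⟨h4, h5.symm, x, hx, z, hz, hxz⟩
      · exact Or.inr ⟨h4, h6.symm, x, hx, z, hz, hxz⟩
    · rintro ⟨⟨h4, -, x, hx, h⟩ | ⟨h4, -, x, hx, h⟩, h5, h6⟩
      · exact ⟨(h1.2 ⟨h4, h5, h6⟩).1, (h1.2 ⟨h4, h5, h6⟩).2, x, Or.inl hx, h⟩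
      · exact ⟨(h1.2 ⟨h4, h5, h6⟩).1, (h1.2 ⟨h4, h5, h6⟩).2, x, Or.inr hx, h⟩
  · ext Z
    have h1 := hmem Z
    constructor
    · rintro ⟨-, h2, h3, h⟩
      obtain ⟨h4, h5, h6⟩ := h1.1 ⟨h2, h3⟩
      exact ⟨⟨hX, h4, h5.symm, fun x hx => h x (Or.inl hx)⟩,
        ⟨hY, h4, h6.symm, fun x hx => h x (Or.inr hx)⟩⟩
    · rintro ⟨⟨-, h4, h5, h⟩, ⟨-, -, h6, h'⟩⟩
      obtain ⟨h2, h3⟩ := h1.2 ⟨h4, h5.symm, h6.symm⟩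
      exact ⟨hUmem, h2, h3, fun x hx => hx.elim (h x) (h' x)⟩
  · rintro Z hZ W hW
    have hZ' : Z ∈ mergeParts C X Y := Or.inl hZ
    have hW' : W ∈ mergeParts C X Y := Or.inl hW
    have hZ1 : Z ∈ C := hZ.1
    have hW1 : W ∈ C := hW.1
    simp only [quotientTrigraph, hZ1, hW1, hZ', hW', true_and, and_self]

theorem isInitial_quotientTrigraph
    (hC : Setoid.IsPartition (Set.range fun v : V => ({v} : Set V))) :
    (quotientTrigraph G _ hC).IsInitial G := by
  refine ⟨rfl, fun u v => ?_, ?_⟩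
  · constructor
    · rintro ⟨-, -, -, h⟩
      exact h u rfl v rfl
    · intro h
      refine ⟨⟨u, rfl⟩, ⟨v, rfl⟩, fun h' => h.ne (Set.singleton_injective h'), ?_⟩
      rintro x rfl y rfl
      exact h
  · ext X Y
    simp only [SimpleGraph.bot_adj, iff_false]
    rintro ⟨⟨u, rfl⟩, ⟨v, rfl⟩, -, ⟨x, rfl, y, rfl, h⟩, ⟨x', hx', y', hy', h'⟩⟩
    rw [Set.mem_singleton_iff] at hx' hy'
    rw [hx', hy'] at h'
    exact h' h

theorem isPartition_singletons : Setoid.IsPartition (Set.range fun v : V => ({v} : Set V)) := by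
  refine ⟨?_, fun a => ⟨{a}, ⟨⟨a, rfl⟩, rfl⟩, ?_⟩⟩
  · rintro ⟨v, h⟩
    exact Set.singleton_ne_empty v h
  · rintro _ ⟨⟨v, rfl⟩, h⟩
    rw [Set.mem_singleton_iff.1 h]

/-- If from every good partition with at least two parts one reaches a good partition by merging
two parts, and good partitions have small red degree, then there is a contraction sequence. -/
theorem exists_isContractionSequence [Finite V] [Nonempty V] {D : ℕ} (Good : Set (Set V) → Prop)
    (h0 : Good (Set.range fun v : V => ({v} : Set V)))
    (hdeg : ∀ C hC, Good C → (quotientTrigraph G C hC).RedDegreeLE D)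
    (hstep : ∀ C, Setoid.IsPartition C → Good C → C.Nontrivial →
      ∃ X ∈ C, ∃ Y ∈ C, X ≠ Y ∧ Good (mergeParts C X Y)) :
    ∃ T, IsContractionSequence G D T := by
  have key : ∀ n, ∀ C hC, Good C → C.ncard = n + 1 → ∃ T : ℕ → Trigraph V,
      T (n + 1) = quotientTrigraph G C hC ∧ (T 1).nodes = {Set.univ} ∧
      (∀ i, 1 ≤ i → i < n + 1 → (T (i + 1)).IsContraction (T i)) ∧
      ∀ i, 1 ≤ i → i ≤ n + 1 → (T i).RedDegreeLE D := by
    intro n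
    induction n with
    | zero =>
      intro C hC hG hn
      refine ⟨fun _ => quotientTrigraph G C hC, rfl, ?_, fun i _ _ => by omega,
        fun i _ _ => hdeg C hC hG⟩
      obtain ⟨X, rfl⟩ := Set.ncard_eq_one.1 hn
      have := Setoid.IsPartition.sUnion_eq_univ hC
      rw [Set.sUnion_singleton] at this
      exact congrArg singleton this
    | succ n ih =>
      intro C hC hG hn
      have hnt : C.Nontrivial := by
        rw [← Set.one_lt_ncard_iff_nontrivial]
        omega
      obtain ⟨X, hX, Y, hY, hXY, hG'⟩ := hstep C hC hG hnt
      have hcard := ncard_mergeParts hC hX hY hXY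
      obtain ⟨T, hT, hT1, hTc, hTd⟩ :=
        ih _ (isPartition_mergeParts hC hX hY) hG' (by omega)
      refine ⟨Function.update T (n + 2) (quotientTrigraph G C hC),
        Function.update_self .., ?_, fun i h1 h2 => ?_, fun i h1 h2 => ?_⟩
      · rw [Function.update_of_ne (by omega)]
        exact hT1
      · rw [Function.update_of_ne (show i ≠ n + 2 by omega)]
        by_cases hi : i = n + 1
        · subst hi
          rw [Function.update_self, hT]
          exact isContraction_quotientTrigraph hC hX hY hXY
        · rw [Function.update_of_ne (by omega)]
          exact hTc i h1 (by omega)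
      · by_cases hi : i = n + 2
        · subst hi
          rw [Function.update_self]
          exact hdeg C hC hG
        · rw [Function.update_of_ne hi]
          exact hTd i h1 (by omega)
  have hcard : (Set.range fun v : V => ({v} : Set V)).ncard = Nat.card V := by
    rw [← Set.image_univ, Set.ncard_image_of_injective _ Set.singleton_injective,
      Set.ncard_univ]
  obtain ⟨n, hn⟩ : ∃ n, Nat.card V = n + 1 := Nat.exists_eq_succ_of_ne_zero Nat.card_pos.ne'
  obtain ⟨T, hT, hT1, hTc, hTd⟩ := key n _ isPartition_singletons h0 (hcard.trans hn)
  rw [← hn] at hT hTc hTd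
  refine ⟨T, ?_, hT1, hTc, hTd⟩
  rw [hT]
  exact isInitial_quotientTrigraph _

end Quotient

/-! ### Upper bound on twin-width -/

section Caterpillar

variable {V : Type*} {G : SimpleGraph V}

/-- Suppose that `ρ` ranks the vertices so that the fibres are modules of pairwise adjacent
vertices, the ranks form an initial segment, and edges stay within blocks of `M` ranks.
Then there is an `M`-contraction sequence. -/
theorem exists_isContractionSequence_of_rank [Finite V] [Nonempty V] {M : ℕ} (hM : 1 ≤ M)
    (ρ : V → ℕ)
    (hmod : ∀ x x' y y', ρ x = ρ x' → ρ y = ρ y' → x ≠ y → x' ≠ y' → G.Adj x y → G.Adj x' y')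
    (hrange : ∀ x, ∀ i ≤ ρ x, ∃ y, ρ y = i)
    (hblock : ∀ x y, G.Adj x y → ρ x / M = ρ y / M) :
    ∃ T, IsContractionSequence G M T := by
  -- Two phases: parts inside fibres of `ρ`, then for some `j` the parts `{ρ ≤ j}` and the single
  -- fibres above `j`. The map `max j ∘ ρ` encodes the second partition.
  refine exists_isContractionSequence (fun C => (∀ X ∈ C, ∀ x ∈ X, ∀ y ∈ X, ρ x = ρ y) ∨
    ∃ j, ∀ X ∈ C, ∀ x ∈ X, ∀ y, y ∈ X ↔ max j (ρ y) = max j (ρ x)) ?_ ?_ ?_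
  · left
    rintro _ ⟨v, rfl⟩ x rfl y rfl
    rfl
  · rintro C hC (h | ⟨j, h⟩) X hX
    · have : (quotientTrigraph G C hC).red.neighborSet X = ∅ := by
        ext Y
        simp only [Set.mem_empty_iff_false, iff_false]
        rintro ⟨-, hY, hXY, ⟨x, hx, y, hy, hadj⟩, ⟨x', hx', y', hy', hnadj⟩⟩
        have hne : ∀ x ∈ X, ∀ y ∈ Y, x ≠ y := by
          rintro x hx y hy rfl
          exact hXY (eq_of_mem_parts hC hX hY hx hy)
        exact hnadj (hmod x x' y y' (h X hX x hx x' hx') (h Y hY y hy y' hy') (hne x hx y hy)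
          (hne x' hx' y' hy') hadj)
      rw [this]
      simp
    · obtain ⟨x₀, hx₀⟩ := Setoid.nonempty_of_mem_partition hC hX
      -- Two fibres are homogeneous, so every red edge meets the part `{ρ ≤ j}`. Its other end is a
      -- fibre above `j` joined by an edge to a rank at most `j`, hence in the block of `j`.
      have hred : ∀ Y ∈ (quotientTrigraph G C hC).red.neighborSet X, ∀ y ∈ Y,
          (j < ρ x₀ ∧ ρ y ≤ j) ∨ (ρ x₀ ≤ j ∧ j < ρ y ∧ ρ y / M = j / M) := by
        rintro Y ⟨-, hY, hXY, ⟨x, hx, y, hy, hadj⟩, ⟨x', hx', y', hy', hnadj⟩⟩ y₀ hy₀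
        have hne : ∀ x ∈ X, ∀ y ∈ Y, x ≠ y := by
          rintro x hx y hy rfl
          exact hXY (eq_of_mem_parts hC hX hY hx hy)
        have e1 := (h X hX x₀ hx₀ x).1 hx
        have e2 := (h X hX x₀ hx₀ x').1 hx'
        have e3 := (h Y hY y₀ hy₀ y).1 hy
        have e4 := (h Y hY y₀ hy₀ y').1 hy'
        have e5 : max j (ρ y₀) ≠ max j (ρ x₀) := by
          intro h'
          exact hne y₀ ((h X hX x₀ hx₀ y₀).2 h') y₀ hy₀ rfl
        by_cases c1 : j < ρ x₀
        · by_cases c2 : ρ y₀ ≤ j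
          · exact Or.inl ⟨c1, c2⟩
          · exact (hnadj (hmod x x' y y' (by omega) (by omega) (hne x hx y hy)
              (hne x' hx' y' hy') hadj)).elim
        · refine Or.inr ⟨by omega, by omega, ?_⟩
          have e6 := hblock x y hadj
          have e7 : ρ y = ρ y₀ := by omega
          have e8 : ρ x / M ≤ j / M := Nat.div_le_div_right (by omega)
          have e9 : j / M ≤ ρ y₀ / M := Nat.div_le_div_right (by omega)
          rw [e7] at e6
          omega
      -- `max j ∘ ρ` is constant on each part; `sInf` merely picks out that value, which then labels
      -- the parts injectively by numbers to be counted.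
      let f : Set V → ℕ := fun Y => sInf ((fun y => max j (ρ y)) '' Y)
      have hf : ∀ Y ∈ C, ∀ y ∈ Y, f Y = max j (ρ y) := by
        intro Y hY y hy
        have : (fun y => max j (ρ y)) '' Y = {max j (ρ y)} := by
          ext i
          constructor
          · rintro ⟨z, hz, rfl⟩
            exact (h Y hY y hy z).1 hz
          · rintro rfl
            exact ⟨y, hy, rfl⟩
        simp only [f]
        rw [this, csInf_singleton]
      have hfinj : Set.InjOn f C := by
        intro Y hY Z hZ hYZ
        obtain ⟨y, hy⟩ := Setoid.nonempty_of_mem_partition hC hY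
        obtain ⟨z, hz⟩ := Setoid.nonempty_of_mem_partition hC hZ
        rw [hf Y hY y hy, hf Z hZ z hz] at hYZ
        exact eq_of_mem_parts hC hY hZ hy ((h Z hZ z hz y).2 hYZ)
      have hsub : (quotientTrigraph G C hC).red.neighborSet X ⊆ C := fun Y hY => hY.2.1
      rw [← (hfinj.mono hsub).encard_image]
      by_cases c1 : j < ρ x₀
      · have : f '' (quotientTrigraph G C hC).red.neighborSet X ⊆ {j} := by
          rintro _ ⟨Y, hY, rfl⟩
          obtain ⟨y, hy⟩ := Setoid.nonempty_of_mem_partition hC (hsub hY)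
          have := hred Y hY y hy
          rw [hf Y (hsub hY) y hy, Set.mem_singleton_iff]
          omega
        refine (Set.encard_le_encard this).trans ?_
        rw [Set.encard_singleton]
        exact_mod_cast hM
      · have : f '' (quotientTrigraph G C hC).red.neighborSet X ⊆
            ((Finset.Ico (j / M * M) (j / M * M + M) : Finset ℕ) : Set ℕ) := by
          rintro _ ⟨Y, hY, rfl⟩
          obtain ⟨y, hy⟩ := Setoid.nonempty_of_mem_partition hC (hsub hY)
          have h1 := hred Y hY y hy
          have h2 : ρ y / M = j / M := by omega
          have h3 := Nat.div_mul_le_self (ρ y) M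
          have h4 := Nat.lt_div_mul_add (a := ρ y) hM
          rw [h2] at h3 h4
          rw [hf Y (hsub hY) y hy, Finset.mem_coe, Finset.mem_Ico]
          omega
        refine (Set.encard_le_encard this).trans ?_
        rw [Set.encard_coe_eq_coe_finsetCard, Nat.card_Ico, Nat.add_sub_cancel_left]
  · intro C hC hgood hnt
    -- While two parts lie in a common fibre they are merged. Once none do, the parts are the fibres
    -- themselves, which is the second phase with `j = 0`.
    by_cases hex : (∀ X ∈ C, ∀ x ∈ X, ∀ y ∈ X, ρ x = ρ y) ∧
        ∃ X ∈ C, ∃ Y ∈ C, X ≠ Y ∧ ∃ x ∈ X, ∃ y ∈ Y, ρ x = ρ y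
    · obtain ⟨h, X, hX, Y, hY, hXY, x, hx, y, hy, hxy⟩ := hex
      refine ⟨X, hX, Y, hY, hXY, Or.inl ?_⟩
      rintro Z (hZ | hZ)
      · exact h Z hZ.1
      · obtain rfl : Z = X ∪ Y := hZ
        have : ∀ z ∈ X ∪ Y, ρ z = ρ x := by
          rintro z (hz | hz)
          · exact h X hX z hz x hx
          · exact (h Y hY z hz y hy).trans hxy.symm
        intro a ha b hb
        rw [this a ha, this b hb]
    · have hj : ∃ j, ∀ X ∈ C, ∀ x ∈ X, ∀ y, y ∈ X ↔ max j (ρ y) = max j (ρ x) := by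
        rcases hgood with h | h
        · refine ⟨0, fun X hX x hx y => ?_⟩
          simp only [Nat.zero_max]
          refine ⟨fun hy => h X hX y hy x hx, fun hxy => ?_⟩
          obtain ⟨Y, ⟨hY, hy⟩, -⟩ := hC.2 y
          by_contra hyX
          refine hex ⟨h, X, hX, Y, hY, ?_, x, hx, y, hy, hxy.symm⟩
          rintro rfl
          exact hyX hy
        · exact h
      obtain ⟨j, h⟩ := hj
      have hbig : ∃ x, j < ρ x := by
        by_contra! hsmall
        obtain ⟨X, hX, Y, hY, hXY⟩ := hnt
        obtain ⟨x, hx⟩ := Setoid.nonempty_of_mem_partition hC hX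
        obtain ⟨y, hy⟩ := Setoid.nonempty_of_mem_partition hC hY
        have h1 := hsmall x
        have h2 := hsmall y
        exact hXY (eq_of_mem_parts hC hX hY ((h X hX x hx y).2 (by omega)) hy)
      obtain ⟨z, hz⟩ := hbig
      obtain ⟨x, hx⟩ := hrange z j hz.le
      obtain ⟨y, hy⟩ := hrange z (j + 1) hz
      obtain ⟨X, ⟨hX, hxX⟩, -⟩ := hC.2 x
      obtain ⟨Y, ⟨hY, hyY⟩, -⟩ := hC.2 y
      refine ⟨X, hX, Y, hY, ?_, Or.inr ⟨j + 1, ?_⟩⟩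
      · rintro rfl
        have := (h X hX x hxX y).1 hyY
        omega
      · have hXiff := h X hX x hxX
        have hYiff := h Y hY y hyY
        rintro Z (⟨hZ, hZ'⟩ | hZ) a ha b
        · have hne : Z ≠ X ∧ Z ≠ Y := ⟨fun h => hZ' (Or.inl h), fun h => hZ' (Or.inr h)⟩
          have h1 : a ∉ X := fun h => hne.1 (eq_of_mem_parts hC hZ hX ha h)
          have h2 : a ∉ Y := fun h => hne.2 (eq_of_mem_parts hC hZ hY ha h)
          rw [hXiff] at h1
          rw [hYiff] at h2
          rw [h Z hZ a ha]
          omega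
        · obtain rfl : Z = X ∪ Y := hZ
          have h1 : ∀ b, b ∈ X ∪ Y ↔ ρ b ≤ j + 1 := by
            intro b
            rw [Set.mem_union, hXiff, hYiff]
            omega
          have h2 := (h1 a).1 ha
          rw [h1]
          omega

end Caterpillar

theorem exists_isContractionSequence_blownUpCopies {m N k s : ℕ} (hm : 1 ≤ m) (hN : 1 ≤ N)
    (hs : 1 ≤ s) : ∃ T, IsContractionSequence (blownUpCopies m N k s)
      (Fintype.card (SubdivVertex N k)) T := by
  have : Nonempty ((Fin m × SubdivVertex N k) × Fin s) :=
    ⟨((⟨0, hm⟩, Sum.inl ⟨0, hN⟩), ⟨0, hs⟩)⟩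
  let M := Fintype.card (SubdivVertex N k)
  -- Copies are numbered consecutively, so division by `M` recovers the index of the copy. The rank
  -- ignores the layer, making its fibres the copies of `K_s`.
  let e : Fin m × SubdivVertex N k ≃ Fin (m * M) :=
    ((Equiv.refl _).prodCongr (Fintype.equivFin _)).trans finProdFinEquiv
  have hM : 1 ≤ M := Fintype.card_pos_iff.2 ⟨Sum.inl ⟨0, hN⟩⟩
  have hinj : ∀ x x', ((e x : Fin (m * M)) : ℕ) = e x' → x = x' := fun x x' h =>
    e.injective (Fin.ext h)
  have hdiv : ∀ x, ((e x : Fin (m * M)) : ℕ) / M = x.1 := by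
    intro x
    have : ((e x : Fin (m * M)) : ℕ) = (Fintype.equivFin _ x.2 : ℕ) + M * x.1 := rfl
    rw [this, Nat.add_mul_div_left _ _ hM, Nat.div_eq_of_lt (Fin.is_lt _), Nat.zero_add]
  refine exists_isContractionSequence_of_rank hM (fun x => (e x.1 : ℕ)) ?_ ?_ ?_
  · rintro ⟨x, i⟩ ⟨x', i'⟩ ⟨y, j⟩ ⟨y', j'⟩ h1 h2 hne hne' h
    obtain rfl := hinj _ _ h1
    obtain rfl := hinj _ _ h2
    rcases h with h | ⟨h, -⟩
    · exact Or.inl h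
    · refine Or.inr ⟨h, ?_⟩
      rw [SimpleGraph.top_adj]
      intro h'
      exact hne' (Prod.ext h h')
  · rintro x i hi
    have hlt : i < m * M := lt_of_le_of_lt hi (e x.1).2
    exact ⟨(e.symm ⟨i, hlt⟩, ⟨0, hs⟩), by simp⟩
  · rintro ⟨x, i⟩ ⟨y, j⟩ h
    change (e x : ℕ) / M = (e y : ℕ) / M
    rw [hdiv, hdiv]
    rcases h with h | ⟨h, -⟩
    · exact congrArg Fin.val h.1
    · exact congrArg (fun z : Fin m × SubdivVertex N k => (z.1 : ℕ)) h

/-! ### Lower bound on twin-width -/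

section Invariant

variable {V : Type*} {G : SimpleGraph V}

/-- The adjacencies of `T` are consistent with those of `G`: nodes joined by an edge of `G` are
adjacent, and black edges stand for complete pairs. -/
structure Trigraph.Represents (T : Trigraph V) (G : SimpleGraph V) : Prop where
  mem_nbr : ∀ X ∈ T.nodes, ∀ Y ∈ T.nodes, X ≠ Y → ∀ x ∈ X, ∀ y ∈ Y, G.Adj x y → Y ∈ T.nbr X
  adj : ∀ X Y, T.black.Adj X Y → ∀ x ∈ X, ∀ y ∈ Y, G.Adj x y

theorem Trigraph.mem_nbr_symm {T : Trigraph V} {X Y : Set V} (h : Y ∈ T.nbr X) : X ∈ T.nbr Y :=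
  h.imp (fun h => T.black.adj_symm h) (fun h => T.red.adj_symm h)

theorem Trigraph.IsInitial.represents {T : Trigraph V} (h : T.IsInitial G) : T.Represents G := by
  obtain ⟨hn, hb, -⟩ := h
  constructor
  · intro X hX Y hY hXY x hx y hy hadj
    rw [hn] at hX hY
    obtain ⟨u, rfl⟩ := hX
    obtain ⟨v, rfl⟩ := hY
    obtain rfl := Set.mem_singleton_iff.1 hx
    obtain rfl := Set.mem_singleton_iff.1 hy
    exact Or.inl ((hb x y).2 hadj)
  · intro X Y hXY x hx y hy
    have hX := T.black_mem X Y hXY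
    have hY := T.black_mem Y X hXY.symm
    rw [hn] at hX hY
    obtain ⟨u, rfl⟩ := hX
    obtain ⟨v, rfl⟩ := hY
    obtain rfl := Set.mem_singleton_iff.1 hx
    obtain rfl := Set.mem_singleton_iff.1 hy
    exact (hb x y).1 hXY

theorem Trigraph.Represents.contract {T T' : Trigraph V} (h : T.Represents G)
    (hc : T.IsContraction T') : T'.Represents G := by
  obtain ⟨X, hX, Y, hY, hXY, hn, hnbr, hblack, hrest⟩ := hc
  have hcases : ∀ Z ∈ T'.nodes, Z = X ∪ Y ∨ Z ∈ T.nodes \ {X, Y} := by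
    intro Z hZ
    rw [hn] at hZ
    exact hZ.symm
  have hU : ∀ Z ∈ T.nodes \ {X, Y}, ∀ x ∈ X ∪ Y, ∀ z ∈ Z, G.Adj x z → Z ∈ T'.nbr (X ∪ Y) := by
    rintro Z ⟨hZ, hZ'⟩ x hx z hz hadj
    rw [hnbr]
    refine ⟨?_, hZ'⟩
    rcases hx with hx | hx
    · exact Or.inl (h.mem_nbr X hX Z hZ (fun e => hZ' (Or.inl e.symm)) x hx z hz hadj)
    · exact Or.inr (h.mem_nbr Y hY Z hZ (fun e => hZ' (Or.inr e.symm)) x hx z hz hadj)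
  have hU' : ∀ Z, T'.black.Adj (X ∪ Y) Z → ∀ x ∈ X ∪ Y, ∀ z ∈ Z, G.Adj x z := by
    intro Z hZ x hx z hz
    have hZ' : Z ∈ T'.black.neighborSet (X ∪ Y) := hZ
    rw [hblack] at hZ'
    rcases hx with hx | hx
    · exact h.adj X Z hZ'.1 x hx z hz
    · exact h.adj Y Z hZ'.2 x hx z hz
  constructor
  · intro A hA B hB hAB a ha b hb hadj
    rcases hcases A hA with rfl | hA' <;> rcases hcases B hB with rfl | hB'
    · exact (hAB rfl).elim
    · exact hU B hB' a ha b hb hadj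
    · exact Trigraph.mem_nbr_symm (hU A hA' b hb a ha hadj.symm)
    · exact (h.mem_nbr A hA'.1 B hB'.1 hAB a ha b hb hadj).imp
        (hrest A hA' B hB').1.2 (hrest A hA' B hB').2.2
  · intro A B hAB a ha b hb
    rcases hcases A (T'.black_mem A B hAB) with rfl | hA'
    · exact hU' B hAB a ha b hb
    · rcases hcases B (T'.black_mem B A hAB.symm) with rfl | hB'
      · exact (hU' A hAB.symm b hb a ha).symm
      · exact h.adj A B ((hrest A hA' B hB').1.1 hAB) a ha b hb

theorem IsContractionSequence.represents {d : ℕ} {T : ℕ → Trigraph V}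
    (h : IsContractionSequence G d T) {i : ℕ} (h1 : 1 ≤ i) (h2 : i ≤ Nat.card V) :
    (T i).Represents G := by
  induction h2 using Nat.decreasingInduction with
  | self => exact h.1.represents
  | of_succ j hj ih => exact (ih (by omega)).contract (h.2.2.1 j h1 hj)

/-- If vertices `b w`, not all in the same position, are to be merged, then at some moment there is
a node with two of them while the remaining ones are still separate. -/
theorem IsContractionSequence.exists_first_merge {d : ℕ} {T : ℕ → Trigraph V}
    (h : IsContractionSequence G d T) {β : Type*} {b : β → V} (hb : Function.Injective b)
    (hβ : ∃ u v : β, u ≠ v) (hV : 1 ≤ Nat.card V) :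
    ∃ i, 1 ≤ i ∧ i ≤ Nat.card V ∧ ∃ u v, u ≠ v ∧
      (∃ P ∈ (T i).nodes, b u ∈ P ∧ b v ∈ P) ∧
      ∀ w w', w ≠ u → w' ≠ u → w ≠ w' → ∀ Q ∈ (T i).nodes, b w ∈ Q → b w' ∉ Q := by
  classical
  let S : ℕ → Prop := fun i => ∀ w w', w ≠ w' → ∀ Q ∈ (T i).nodes, b w ∈ Q → b w' ∉ Q
  have hSn : S (Nat.card V) := by
    intro w w' hne Q hQ hw hw'
    rw [h.1.1] at hQ
    obtain ⟨x, rfl⟩ := hQ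
    exact hne (hb ((Set.mem_singleton_iff.1 hw).trans (Set.mem_singleton_iff.1 hw').symm))
  have hS1 : ¬ S 1 := by
    obtain ⟨u, v, huv⟩ := hβ
    intro hS
    exact hS u v huv Set.univ (by rw [h.2.1]; rfl) trivial trivial
  -- Contraction lowers the index, so `i + 1` is the trigraph just before the vertices `b w` cease
  -- to be separated.
  obtain ⟨i, h1, h2, hi, hi'⟩ : ∃ i, 1 ≤ i ∧ i < Nat.card V ∧ ¬ S i ∧ S (i + 1) := by
    by_contra! hcon
    have : ∀ j, j + 1 ≤ Nat.card V → ¬ S (j + 1) := by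
      intro j
      induction j with
      | zero => exact fun _ => hS1
      | succ j ih => exact fun hj => hcon (j + 1) (by omega) hj (ih (by omega))
    exact this (Nat.card V - 1) (by omega) (by rwa [Nat.sub_add_cancel hV])
  refine ⟨i, h1, h2.le, ?_⟩
  obtain ⟨X, hX, Y, hY, hXY, hn, -⟩ := h.2.2.1 i h1 h2
  simp only [S, not_forall] at hi
  obtain ⟨u, v, huv, P, hP, hu, hv⟩ := hi
  rw [not_not] at hv
  have hPU : P = X ∪ Y := by
    rw [hn] at hP
    exact hP.resolve_left fun hP => hi' u v huv P hP.1 hu hv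
  refine ⟨u, v, huv, ⟨P, hP, hu, hv⟩, ?_⟩
  intro w w' hw hw' hne Q hQ hwQ hwQ'
  rw [hn] at hQ
  rcases hQ with hQ | hQ
  · exact hi' w w' hne Q hQ.1 hwQ hwQ'
  · obtain rfl : Q = X ∪ Y := hQ
    rw [hPU] at hu
    -- Before the contraction `X` and `Y` each held at most one `b w`. Three of them, `u`, `w` and
    -- `w'`, cannot fit.
    rcases hwQ with h3 | h3 <;> rcases hwQ' with h4 | h4 <;> rcases hu with h5 | h5
    · exact hi' w w' hne X hX h3 h4
    · exact hi' w w' hne X hX h3 h4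
    · exact hi' w u hw X hX h3 h5
    · exact hi' w' u hw' Y hY h4 h5
    · exact hi' w' u hw' X hX h4 h5
    · exact hi' w u hw Y hY h3 h5
    · exact hi' w w' hne Y hY h3 h4
    · exact hi' w w' hne Y hY h3 h4

end Invariant

section Counting

variable {N k D : ℕ} {α : Type*}

/-- If a colouring of the vertices of the subdivided clique gives the same colour to two branch
vertices, separates all other pairs of branch vertices, and has few inhomogeneous pairs at each
colour, then the clique is small. -/
theorem pred_le_of_colouring (hk : 2 ≤ k) (c : SubdivVertex N k → α) (R : α → α → Prop)
    (hR : ∀ q, {q' | R q q'}.encard ≤ D)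
    (hhom : ∀ a a' b b', c a = c a' → c b = c b' → c a ≠ c b →
      (subdividedClique N k).Adj a b → ¬ (subdividedClique N k).Adj a' b' → R (c a) (c b))
    {u v : Fin N} (huv : u ≠ v) (hcuv : c (Sum.inl u) = c (Sum.inl v))
    (hsep : ∀ w w', w ≠ u → w' ≠ u → c (Sum.inl w) = c (Sum.inl w') → w = w') :
    N - 1 ≤ (D + 1) * (D + 2) ^ k := by
  classical
  let S : Finset (Fin N) := Finset.univ.erase u
  have hS : ∀ w ∈ S, w ≠ u := fun w hw => Finset.ne_of_mem_erase hw
  -- `A t` collects the colours met at position `t` on the paths from `u` to the other branch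
  -- vertices.
  let A : ℕ → Finset α := fun t => S.image fun w => c (edgePoint u w t)
  have hfin : ∀ q, {q' | R q q'}.Finite := fun q =>
    Set.finite_of_encard_le_coe (hR q)
  -- The colour `q` itself is included because `hhom` speaks only of distinct colours.
  let F : α → Finset α := fun q => insert q (hfin q).toFinset
  have hFmem : ∀ q q', q' ∈ F q ↔ q' = q ∨ R q q' := fun q q' => by simp [F]
  have hFcard : ∀ q, (F q).card ≤ D + 1 := by
    intro q
    refine (Finset.card_insert_le _ _).trans (Nat.add_le_add_right ?_ 1)
    have := hR q
    rw [(hfin q).encard_eq_coe_toFinset_card] at this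
    exact_mod_cast this
  -- No neighbour of `u` is a neighbour of `v`, so no other colour can be completely joined to the
  -- colour shared by `u` and `v`.
  have hA1 : (A 1).card ≤ D + 1 := by
    refine (Finset.card_le_card ?_).trans (hFcard (c (Sum.inl u)))
    intro q hq
    obtain ⟨w, hw, rfl⟩ := Finset.mem_image.1 hq
    rw [hFmem]
    by_contra! hcon
    have hadj := adj_edgePoint (k := k) (by omega) (hS w hw) (t := 0) (by omega)
    rw [edgePoint_zero] at hadj
    refine hcon.2 (hhom _ (Sum.inl v) _ (edgePoint u w (0 + 1)) hcuv rfl hcon.1.symm hadj ?_)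
    intro hadj'
    exact huv (inl_eq_of_common_neighbor hk hadj hadj')
  have hAstep : ∀ t, 1 ≤ t → t ≤ k → (A (t + 1)).card ≤ (A t).card * (D + 2) := by
    intro t h1 ht
    let B : α → Finset α := fun q =>
      (S.filter fun w => c (edgePoint u w t) = q).image fun w => c (edgePoint u w (t + 1))
    have hsub : A (t + 1) ⊆ (A t).biUnion B := by
      intro q hq
      obtain ⟨w, hw, rfl⟩ := Finset.mem_image.1 hq
      exact Finset.mem_biUnion.2 ⟨_, Finset.mem_image_of_mem _ hw,
        Finset.mem_image_of_mem _ (Finset.mem_filter.2 ⟨hw, rfl⟩)⟩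
    refine (Finset.card_le_card hsub).trans (Finset.card_biUnion_le_card_mul _ _ _ fun q _ => ?_)
    -- Two successors with colours outside `F q` would both be adjacent to both of their
    -- predecessors in `q`, giving a four-cycle. So from each `q` at most `(D + 1) + 1` colours are
    -- reached.
    have hbad : (B q \ F q).card ≤ 1 := by
      rw [Finset.card_le_one]
      intro q₁ hq₁ q₂ hq₂
      rw [Finset.mem_sdiff, hFmem] at hq₁ hq₂
      obtain ⟨hq₁, hq₁'⟩ := hq₁
      obtain ⟨hq₂, hq₂'⟩ := hq₂
      obtain ⟨w₁, hw₁, rfl⟩ := Finset.mem_image.1 hq₁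
      obtain ⟨w₂, hw₂, rfl⟩ := Finset.mem_image.1 hq₂
      rw [Finset.mem_filter] at hw₁ hw₂
      obtain ⟨hw₁, rfl⟩ := hw₁
      obtain ⟨hw₂, hw₂'⟩ := hw₂
      push Not at hq₁' hq₂'
      have hadj₁ := adj_edgePoint (k := k) (by omega) (hS _ hw₁) ht
      have hadj₂ := adj_edgePoint (k := k) (by omega) (hS _ hw₂) ht
      have h12 : (subdividedClique N k).Adj (edgePoint u w₂ t) (edgePoint u w₁ (t + 1)) := by
        by_contra hcon
        exact hq₁'.2 (hhom _ _ _ _ hw₂'.symm rfl hq₁'.1.symm hadj₁ hcon)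
      have h21 : (subdividedClique N k).Adj (edgePoint u w₁ t) (edgePoint u w₂ (t + 1)) := by
        by_contra hcon
        refine hq₂'.2 ?_
        have := hhom _ (edgePoint u w₁ t) _ (edgePoint u w₂ (t + 1)) hw₂' rfl
          (by rw [hw₂']; exact hq₂'.1.symm) hadj₂ hcon
        rwa [hw₂'] at this
      rcases eq_or_eq_of_four_cycle hk hadj₁ h21 h12 hadj₂ with h | h
      · rw [(edgePoint_inj (hS _ hw₁) (hS _ hw₂) (by omega) (by omega) (by omega)
          (by omega) h).1]
      · rw [h]
    have h3 := Finset.card_le_card_sdiff_add_card (s := B q) (t := F q)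
    have h4 := hFcard q
    omega
  have hAk : ∀ t, t ≤ k → (A (t + 1)).card ≤ (D + 1) * (D + 2) ^ t := by
    intro t
    induction t with
    | zero => intro _; simpa using hA1
    | succ t ih =>
      intro ht
      refine (hAstep (t + 1) (by omega) ht).trans ?_
      rw [pow_succ, ← mul_assoc]
      exact Nat.mul_le_mul_right _ (ih (by omega))
  have hlast : (A (k + 1)).card = N - 1 := by
    have : S.card = N - 1 := by simp [S]
    rw [← this]
    refine Finset.card_image_of_injOn ?_
    intro w hw w' hw' h
    simp only [edgePoint_last] at h
    exact hsep w w' (hS w hw) (hS w' hw') h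
  rw [← hlast]
  exact hAk k le_rfl

end Counting

/-- The colour of a vertex is its node at the moment when two branch vertices first share one. An
inhomogeneous pair of distinct nodes that contains an edge of `G` must then be red. -/
theorem pred_le_of_isContractionSequence {V : Type*} [Finite V] {G : SimpleGraph V} {N k D : ℕ}
    (hk : 2 ≤ k) (hN : 2 ≤ N) (φ : subdividedClique N k ↪g G) {T : ℕ → Trigraph V}
    (h : IsContractionSequence G D T) : N - 1 ≤ (D + 1) * (D + 2) ^ k := by
  have hV : 1 ≤ Nat.card V := by
    have : Nonempty V := ⟨φ (Sum.inl ⟨0, by omega⟩)⟩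
    exact Nat.card_pos
  obtain ⟨i, h1, h2, u, v, huv, ⟨P, hP, huP, hvP⟩, hsep⟩ :=
    h.exists_first_merge (b := fun w : Fin N => φ (Sum.inl w))
      (φ.injective.comp Sum.inl_injective)
      ⟨⟨0, by omega⟩, ⟨1, by omega⟩, by simp⟩ hV
  have hrep := h.represents h1 h2
  have hpart := (T i).isPartition
  choose c hc using fun x => (hpart.2 x).exists
  refine pred_le_of_colouring hk (fun a => c (φ a)) (fun X Y => X ∈ (T i).nodes ∧
    (T i).red.Adj X Y) ?_ ?_ huv ?_ ?_
  · intro X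
    by_cases hX : X ∈ (T i).nodes
    · refine (Set.encard_le_encard ?_).trans (h.2.2.2 i h1 h2 X hX)
      exact fun Y hY => hY.2
    · simp [hX]
  · intro a a' b b' ha hb hne hadj hnadj
    have hca := hc (φ a)
    have hcb := hc (φ b)
    refine ⟨hca.1, ?_⟩
    rcases hrep.mem_nbr _ hca.1 _ hcb.1 hne _ hca.2 _ hcb.2 (φ.map_adj_iff.2 hadj) with h | h
    · refine (hnadj (φ.map_adj_iff.1 (hrep.adj _ _ h _ ?_ _ ?_))).elim
      · rw [ha]
        exact (hc _).2
      · rw [hb]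
        exact (hc _).2
    · exact h
  · rw [eq_of_mem_parts hpart (hc _).1 hP (hc _).2 huP,
      eq_of_mem_parts hpart (hc _).1 hP (hc _).2 hvP]
  · intro w w' hw hw' hww
    by_contra hne
    refine hsep w w' hw hw' hne _ (hc _).1 (hc (φ (Sum.inl w))).2 ?_
    rw [hww]
    exact (hc _).2

/-! ### Numerical estimates and conclusion -/

theorem copies_adj_of_adj {V : Type*} {G : SimpleGraph V} {m : ℕ} (hm : 1 ≤ m) {a b : V}
    (h : G.Adj a b) : (copies m G).Adj (⟨0, hm⟩, a) (⟨0, hm⟩, b) :=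
  ⟨rfl, h⟩

/-- A subdivided clique is an induced subgraph of its blown-up copies. -/
def embedBlownUpCopies {m N k s : ℕ} (hm : 1 ≤ m) (hs : 1 ≤ s) :
    subdividedClique N k ↪g blownUpCopies m N k s where
  toFun a := ((⟨0, hm⟩, a), ⟨0, hs⟩)
  inj' a b h := by simpa using h
  map_rel_iff' := by
    intro a b
    constructor
    · rintro (h | h)
      · exact h.2
      · exact (h.2 rfl).elim
    · exact fun h => Or.inl ⟨rfl, h⟩

/-- The surplus `2` makes `d * (d + 1) ^ k` strictly smaller than `N - 1`. For `d = 2` the estimate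
fails at `k = 2`, since `20 > 16`, and holds at `k = 3`, since `56 ≤ 64`. -/
theorem mul_succ_pow_add_two_le {d k : ℕ} (hd : 2 ≤ d) (hk : 3 ≤ k) :
    d * (d + 1) ^ k + 2 ≤ d ^ (2 * k) := by
  induction k, hk using Nat.le_induction with
  | base =>
    obtain ⟨e, rfl⟩ := Nat.exists_eq_add_of_le hd
    ring_nf
    nlinarith [Nat.zero_le e, Nat.zero_le (e ^ 2), Nat.zero_le (e ^ 3), Nat.zero_le (e ^ 4),
      Nat.zero_le (e ^ 5), Nat.zero_le (e ^ 6)]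
  | succ k hk ih =>
    have h1 : d + 1 ≤ d ^ 2 := by nlinarith
    calc d * (d + 1) ^ (k + 1) + 2 ≤ (d * (d + 1) ^ k + 2) * (d + 1) := by
          rw [pow_succ]
          nlinarith
      _ ≤ d ^ (2 * k) * d ^ 2 := Nat.mul_le_mul ih h1
      _ = d ^ (2 * (k + 1)) := by rw [← pow_add, mul_add, mul_one]

theorem le_tww_blownUpCopies {m d k s : ℕ} (hm : 1 ≤ m) (hd : 2 ≤ d) (hk : 3 ≤ k) (hs : 1 ≤ s) :
    d ≤ tww (blownUpCopies m (d ^ (2 * k)) k s) := by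
  have harith := mul_succ_pow_add_two_le hd hk
  have hN : 2 ≤ d ^ (2 * k) := by omega
  -- The upper bound is needed here too: `sInf ∅ = 0` would defeat the lower bound.
  refine le_csInf ⟨_, exists_isContractionSequence_blownUpCopies hm (by omega) hs⟩ ?_
  rintro D ⟨T, hT⟩
  by_contra! hlt
  have h1 := pred_le_of_isContractionSequence (by omega) hN (embedBlownUpCopies hm hs) hT
  have h2 : (D + 1) * (D + 2) ^ k ≤ d * (d + 1) ^ k :=
    Nat.mul_le_mul hlt (Nat.pow_le_pow_left (by omega) k)
  omega

theorem card_subdivVertex_le {N k : ℕ} (hN : 64 ≤ N) (hk : k ≤ N) :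
    Fintype.card (SubdivVertex N k) ≤ 2 ^ (N - 1) := by
  have h1 : Fintype.card {e : Fin N × Fin N // e.1 < e.2} ≤ N * N := by
    refine (Fintype.card_subtype_le _).trans ?_
    simp
  have h2 : Fintype.card (SubdivVertex N k) ≤ N + N * N * N := by
    rw [Fintype.card_sum, Fintype.card_prod, Fintype.card_fin, Fintype.card_fin]
    exact Nat.add_le_add_left (Nat.mul_le_mul h1 hk) N
  refine h2.trans ?_
  clear h1 h2 hk
  induction N, hN using Nat.le_induction with
  | base => norm_num
  | succ n hn ih =>
    obtain ⟨l, rfl⟩ : ∃ l, n = l + 1 := ⟨n - 1, by omega⟩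
    rw [Nat.add_sub_cancel] at ih ⊢
    rw [pow_succ]
    nlinarith

/-- The first logarithm already gives `n`; the second is spent on `n ≤ 2 ^ n`. The bound `2 ≤ t`
keeps the inner logarithm positive. -/
theorem logb_logb_le {t n : ℕ} (ht : 2 ≤ t) (htn : t ≤ 2 ^ n) :
    Real.logb 2 (Real.logb 2 (t : ℝ)) ≤ n := by
  have ht' : (2 : ℝ) ≤ t := by exact_mod_cast ht
  have htn' : (t : ℝ) ≤ 2 ^ (n : ℝ) := by
    rw [Real.rpow_natCast]
    exact_mod_cast htn
  have h1 : 1 ≤ Real.logb 2 (t : ℝ) := by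
    rw [Real.le_logb_iff_rpow_le one_lt_two (by linarith), Real.rpow_one]
    exact ht'
  have h2 : Real.logb 2 (t : ℝ) ≤ n :=
    (Real.logb_le_iff_le_rpow one_lt_two (by linarith)).2 htn'
  rw [Real.logb_le_iff_le_rpow one_lt_two (by linarith), Real.rpow_natCast]
  refine h2.trans ?_
  exact_mod_cast Nat.lt_two_pow_self.le

end TwinWidthAdm

theorem mainTheorem9 :
    ∃ ε : ℝ, 0 < ε ∧
      ∀ d r s n : ℕ, 2 ≤ d → 4 ≤ r → 1 ≤ s → 1 ≤ n →
        ∃ (V : Type) (_ : Fintype V) (G : SimpleGraph V),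
          (∃ m : ℕ, 1 ≤ m ∧
            Nonempty (G ≃g TwinWidthAdm.lexProduct
              (TwinWidthAdm.copies m
                (TwinWidthAdm.subdividedClique (d ^ (2 * (r - 1))) (r - 1)))
              (⊤ : SimpleGraph (Fin s)))) ∧
          (completeBipartiteGraph (Fin (s + 1)) (Fin (s + 1))).Free G ∧
          n ≤ Fintype.card V ∧
          TwinWidthAdm.bomega G = s ∧
          d ≤ TwinWidthAdm.tww G ∧
          (Real.logb 2 (Real.logb 2 (TwinWidthAdm.tww G : ℝ))) ^ ε * (TwinWidthAdm.bomega G : ℝ)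
            ≤ (TwinWidthAdm.adm r G : ℝ) := by
  refine ⟨1, one_pos, fun d r s n hd hr hs hn => ?_⟩
  obtain ⟨k, rfl⟩ : ∃ k, r = k + 1 := ⟨r - 1, by omega⟩
  rw [Nat.add_sub_cancel]
  have hk : 3 ≤ k := by omega
  have hN' : 2 ^ (2 * k) ≤ d ^ (2 * k) := Nat.pow_le_pow_left hd _
  have hN : 64 ≤ d ^ (2 * k) := by
    refine le_trans ?_ hN'
    exact (Nat.pow_le_pow_right (by norm_num) (by omega) : 2 ^ 6 ≤ 2 ^ (2 * k))
  have hkN : k ≤ d ^ (2 * k) := by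
    have : 2 * k < 2 ^ (2 * k) := Nat.lt_two_pow_self
    omega
  have htww := TwinWidthAdm.le_tww_blownUpCopies (m := n) (s := s) hn hd hk hs
  have hle := TwinWidthAdm.exists_isContractionSequence_blownUpCopies (m := n) (k := k)
    (N := d ^ (2 * k)) hn (by omega) hs
  have hadm := TwinWidthAdm.le_adm_blownUpCopies (m := n) (N := d ^ (2 * k)) (k := k) hn
    (by omega) (by omega) hs
  -- From here on only `64 ≤ N`, `k ≤ N` and the bounds just obtained matter.
  generalize d ^ (2 * k) = N at *
  have hfree : (completeBipartiteGraph (Fin (s + 1)) (Fin (s + 1))).Free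
      (TwinWidthAdm.blownUpCopies n N k s) := by
    refine TwinWidthAdm.completeBipartite_free_lexProduct _ ?_ ?_
    · rintro x y z ⟨-, h1⟩ ⟨-, h2⟩ ⟨-, h3⟩
      exact TwinWidthAdm.not_triangle hk h1 h2 h3
    · rintro x y z w ⟨e1, h1⟩ ⟨e2, h2⟩ ⟨e3, h3⟩ ⟨-, h4⟩
      exact (TwinWidthAdm.eq_or_eq_of_four_cycle (by omega) h1 h2 h3 h4).imp
        (Prod.ext (e1.trans e3.symm)) (Prod.ext (e1.symm.trans e2))
  have hbomega : TwinWidthAdm.bomega (TwinWidthAdm.blownUpCopies n N k s) = s := by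
    have hedge := TwinWidthAdm.adj_edgePoint (N := N) (k := k) (by omega) (x := ⟨0, by omega⟩)
      (w := ⟨1, by omega⟩) (by simp) (Nat.zero_le k)
    exact TwinWidthAdm.bomega_eq (TwinWidthAdm.completeBipartite_isContained_lexProduct _
      (TwinWidthAdm.copies_adj_of_adj hn hedge)) hfree
  refine ⟨_, inferInstance, TwinWidthAdm.blownUpCopies n N k s,
    ⟨n, hn, ⟨SimpleGraph.Iso.refl⟩⟩, hfree, ?_, hbomega, htww, ?_⟩
  · rw [Fintype.card_prod, Fintype.card_prod, Fintype.card_fin, Fintype.card_fin]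
    have : 1 ≤ Fintype.card (TwinWidthAdm.SubdivVertex N k) :=
      Fintype.card_pos_iff.2 ⟨Sum.inl ⟨0, by omega⟩⟩
    exact (Nat.le_mul_of_pos_right n this).trans (Nat.le_mul_of_pos_right _ hs)
  · rw [Real.rpow_one, hbomega]
    have hlog := TwinWidthAdm.logb_logb_le (hd.trans htww)
      ((Nat.sInf_le hle).trans (TwinWidthAdm.card_subdivVertex_le hN hkN))
    refine (mul_le_mul_of_nonneg_right hlog (Nat.cast_nonneg s)).trans ?_
    exact_mod_cast hadm
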